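/- **Setting.** Let $\mathbf V$ be a finite set of variables, each $V\in\mathbf V$ with a nonempty measurable domain $\mathcal D_V$, and write $\mathcal D_{\mathbf W}=\prod_{W\in\mathbf W}\mathcal D_W$. A labeled DAG $\mathcal G^{\mathcal L}=(\mathbf V,\mathbf E,\mathcal L)$ is a DAG $(\mathbf V,\mathbf E)$ with, for each edge $(V_i,V_j)$, a (possibly empty) set $\mathcal L_{(V_i,V_j)}$ of labels $\ell\in\mathcal D_{\mathbf V'}$, $\mathbf V'\subseteq\mathbf{Pa}(V_j)\setminus\{V_i\}$. The set $\mathbf C=\mathbf C(\mathcal L)$ of context variables consists of the variables that occur in some label; their domains are assumed countable and discrete. An SCM $M$ on $(\mathbf V,\mathbf E)$ assigns $V\gets f_V(\mathbf{Pa}(V),U_V)$ with measurable $f_V$ and mutually independent exogenous variables $(U_V)_{V\in\mathbf V}$. It satisfies the local context-specific independence $V_i\perp\!\!\!\perp V_j\mid\ell$ if the law of $f_{V_j}(\mathbf{pa},U_{V_j})$ does not depend on the value of $V_i$ as long as $\mathbf{pa}$ agrees with $\ell$. It is compatible with $\mathcal G^{\mathcal L}$, written $M\in\mathcal M_{\langle\mathcal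 G^{\mathcal L}\rangle}$, if it satisfies $V_i\perp\!\!\!\perp V_j\mid\ell$ for every $\ell\in\mathcal L_{(V_i,V_j)}$. A DAG is a labeled DAG without labels. Let $\mathbf O\subseteq\mathbf V$ be the observed variables, $X\in\mathbf O$ the action, $Y\in\mathbf V$ the reward, and $\mathbf{Pa}^\Pi\subseteq\mathbf O\setminus\mathbf{De}(X)$, where $X\in\mathbf{De}(X)$. The policy space $\Pi$ consists of all Markov kernels $\pi(\cdot\mid\mathbf{pa}^\Pi)$ from $\mathcal D_{\mathbf{Pa}^\Pi}$ to $\mathcal D_X$, and $do(\pi)$ replaces the function $f_X$ by the random mechanism $\pi$. $P(y)$ is *imitable* w.r.t. $\langle\mathcal G^{\mathcal L},\Pi\rangle$ if there is a map $\Phi$ from distributions over $\mathbf O$ to $\Pi$ such that $P^M(y\mid do(\Phi(P^M(\mathbf O))))=P^M(y)$ for every $M\in\mathcal M_{\langle\mathcal G^{\mathcal L}\rangle}$, i.e. every compatible model has an imitating policy that is determined by its observational distribution. For a DAG this is classical imitability. For $\mathbf c\in\mathcal D_{\mathbf C}$ let $\mathcal G_{\mathbf c}$ be the DAG on $\mathbf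 V$ obtained from $(\mathbf V,\mathbf E)$ by deleting all edges incident to $\mathbf C$ and all edges $(V_i,V_j)$ that are absent in the context $\mathbf c$, i.e. for which some part $\ell$ of $\mathbf c$, $\ell\in\mathcal D_{\mathbf V'}$ with $\mathbf V'\subseteq\mathbf C\cap\mathbf{Pa}(V_j)\setminus\{V_i\}$, has the property that $V_i\perp\!\!\!\perp V_j\mid\ell$ holds in every $M\in\mathcal M_{\langle\mathcal G^{\mathcal L}\rangle}$ (in particular every edge with a label in $\mathcal L_{(V_i,V_j)}$ that is part of $\mathbf c$). **Proposition.** Assume that $\mathbf{Pa}(\mathbf C(\mathcal L))\subseteq\mathbf C(\mathcal L)$ and $\mathbf C(\mathcal L)\subseteq\mathbf{Pa}^\Pi$. Then $P(y)$ is imitable w.r.t. $\langle\mathcal G^{\mathcal L},\Pi\rangle$ if and only if $P(y)$ is (classically) imitable w.r.t. $\langle\mathcal G_{\mathbf c},\Pi\rangle$ for every $\mathbf c\in\mathcal D_{\mathbf C(\mathcal L)}$. -/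

import Mathlib

open MeasureTheory ProbabilityTheory

universe u v

namespace CSIImitation

/-- A realization of a set of variables: a set `dom` of variables with a value for each of them.
`D w` is the domain of the variable `w`. -/
structure Realization {V : Type v} (D : V → Type u) where
  dom : Set V
  val : ∀ w : dom, D w

/-- A labeled DAG on the vertex set `V`: `edge i j` is the edge `i → j`, and `label i j` is the
set of labels put on that edge, each of them a realization of some parents of `j` other than
`i`. A DAG is a labeled DAG all of whose label sets are empty. -/
structure LDAG {V : Type v} (D : V → Type u) where
  edge : V → V → Prop
  acyclic : ∀ w, ¬ Relation.TransGen edge w w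
  label : V → V → Set (Realization D)
  label_edge : ∀ i j, ∀ l ∈ label i j, edge i j
  label_dom : ∀ i j, ∀ l ∈ label i j, ∀ w ∈ l.dom, edge w j ∧ w ≠ i

namespace LDAG

variable {V : Type v} {D : V → Type u}

/-- The parents of `w`. -/
def Pa (G : LDAG D) (w : V) : Set V := {p | G.edge p w}

/-- The descendants of `x`, including `x` itself. -/
def De (G : LDAG D) (x : V) : Set V := {w | Relation.ReflTransGen G.edge x w}

/-- The context variables: those that occur in some label. -/
def context (G : LDAG D) : Set V := {w | ∃ k j, ∃ l ∈ G.label k j, w ∈ l.dom}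

theorem edge_wf [Finite V] (G : LDAG D) : WellFounded G.edge := by
  have : Std.Irrefl (Relation.TransGen G.edge) := ⟨G.acyclic⟩
  have : IsTrans V (Relation.TransGen G.edge) := ⟨fun _ _ _ => Relation.TransGen.trans⟩
  exact Subrelation.wf (fun h => Relation.TransGen.single h)
    (Finite.wellFounded_of_trans_of_irrefl (Relation.TransGen G.edge))

end LDAG

/-- A structural causal model on the DAG underlying `G`. Each variable `w` has an exogenous
variable with values in `U w` and law `P w`; the exogenous variables are mutually independent
(latent common causes are vertices of the graph). The value of `w` is `f w` applied to the values
of its parents and to its exogenous variable. -/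
structure SCM {V : Type v} {D : V → Type u} [∀ w, MeasurableSpace (D w)] (G : LDAG D) where
  U : V → Type u
  mU : ∀ w, MeasurableSpace (U w)
  P : ∀ w, Measure (U w)
  prob : ∀ w, IsProbabilityMeasure (P w)
  f : ∀ w, (∀ p : G.Pa w, D p) → U w → D w
  measurable_f : ∀ w, Measurable fun a : (∀ p : G.Pa w, D p) × U w => f w a.1 a.2

attribute [instance] SCM.mU SCM.prob

namespace SCM

variable {V : Type v} {D : V → Type u} [∀ w, MeasurableSpace (D w)] {G : LDAG D}

/-- The law of `w` when its parents take the values `pa`. -/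
noncomputable def mechanism (M : SCM G) (w : V) (pa : ∀ p : G.Pa w, D p) : Measure (D w) :=
  (M.P w).map (M.f w pa)

/-- The local context-specific independence of `j` from its parent `i` in the context `l`: as long
as the parents of `j` agree with `l`, the law of `j` given its parents does not depend on the
value of `i`. -/
def LocalCSI (M : SCM G) (i j : V) (l : Realization D) : Prop :=
  ∀ pa pa' : ∀ p : G.Pa j, D p,
    (∀ (p : G.Pa j) (h : (p : V) ∈ l.dom), pa p = l.val ⟨p, h⟩) →
    (∀ (p : G.Pa j) (h : (p : V) ∈ l.dom), pa' p = l.val ⟨p, h⟩) →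
    (∀ p : G.Pa j, (p : V) ≠ i → pa p = pa' p) →
    M.mechanism j pa = M.mechanism j pa'

/-- The model belongs to the class of models compatible with the labeled DAG `G`: each label is
a local context-specific independence of the model. -/
def Compatible (M : SCM G) : Prop :=
  ∀ i j, ∀ l ∈ G.label i j, M.LocalCSI i j l

/-- The values of all variables, as a function of the exogenous variables. -/
noncomputable def sol [Finite V] (M : SCM G) (e : ∀ w, M.U w) : ∀ w, D w :=
  G.edge_wf.fix fun w ih => M.f w (fun p => ih p p.2) (e w)

/-- The joint law of the exogenous variables. -/
noncomputable def noise [Fintype V] (M : SCM G) : Measure (∀ w, M.U w) :=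
  Measure.pi M.P

/-- The joint law of all variables. -/
noncomputable def law [Fintype V] (M : SCM G) : Measure (∀ w, D w) :=
  M.noise.map M.sol

/-- The observational distribution: the joint law of the variables in `O`. -/
noncomputable def obs [Fintype V] (M : SCM G) (O : Set V) : Measure (∀ w : O, D w) :=
  M.law.map fun a w => a w

open Classical in
/-- The values of all variables after the intervention `do(X = x)`, as a function of the exogenous
variables: the function of `X` is replaced by the constant `x`. -/
noncomputable def solDo [Finite V] (M : SCM G) (X : V) (x : D X) (e : ∀ w, M.U w) : ∀ w, D w :=
  G.edge_wf.fix fun w ih => if h : w = X then h ▸ x else M.f w (fun p => ih p p.2) (e w)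

end SCM

/-- The policy space: the stochastic maps from the values of the variables `PaPi` to the action
`X`. -/
def Policy {V : Type v} (D : V → Type u) [∀ w, MeasurableSpace (D w)] (X : V) (PaPi : Set V) :
    Type (max u v) :=
  {π : Kernel (∀ w : PaPi, D w) (D X) // IsMarkovKernel π}

/-- The joint law of all variables after the intervention `do(π)`: the exogenous variables are
drawn, `X` is drawn from `π` at the values of `PaPi` (which are not affected by `X`), and the
other variables follow their own mechanisms. -/
noncomputable def SCM.doPolicy {V : Type v} [Fintype V] {D : V → Type u}
    [∀ w, MeasurableSpace (D w)] {G : LDAG D} (M : SCM G) {X : V} {PaPi : Set V}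
    (π : Policy D X PaPi) : Measure (∀ w, D w) :=
  M.noise.bind fun e => (π.1 fun w => M.sol e w).map fun x => M.solDo X x e

/-- `P(y)` is imitable: a policy that is a function of the observational distribution alone
reproduces the law of `Y`, whatever the model compatible with `G`. -/
def Imitable {V : Type v} [Fintype V] {D : V → Type u} [∀ w, MeasurableSpace (D w)]
    (G : LDAG D) (O : Set V) (X Y : V) (PaPi : Set V) : Prop :=
  ∃ Φ : Measure (∀ w : O, D w) → Policy D X PaPi, ∀ M : SCM G, M.Compatible →
    (M.doPolicy (Φ (M.obs O))).map (fun a => a Y) = M.law.map (fun a => a Y)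

namespace LDAG

variable {V : Type v} {D : V → Type u} [∀ w, MeasurableSpace (D w)]

/-- All labels of the edge `i → j`: the realizations `l` of parents of `j` other than `i` such
that `j` is independent of `i` in the context `l`, in every compatible model. They comprise
`G.label i j` and the independences that follow from the labels of `G` taken together. -/
def fullLabel (G : LDAG D) (i j : V) : Set (Realization D) :=
  {l | (∀ w ∈ l.dom, G.edge w j ∧ w ≠ i) ∧ ∀ M : SCM G, M.Compatible → M.LocalCSI i j l}

/-- The edge `i → j` is absent in the context `c`: it has a label that is part of `c`. -/
def Absent (G : LDAG D) (c : ∀ w : G.context, D w) (i j : V) : Prop :=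
  ∃ l ∈ G.fullLabel i j, ∃ h : l.dom ⊆ G.context, ∀ w : l.dom, l.val w = c ⟨w, h w.2⟩

/-- The context-induced subgraph for a realization `c` of all context variables: the edges that
are absent in the context `c` and the edges incident to a context variable are deleted. No label
is left, so it is a DAG. -/
def induced (G : LDAG D) (c : ∀ w : G.context, D w) : LDAG D where
  edge i j := G.edge i j ∧ i ∉ G.context ∧ j ∉ G.context ∧ ¬ G.Absent c i j
  acyclic w h := G.acyclic w (Relation.TransGen.mono (fun _ _ h => h.1) w w h)
  label _ _ := ∅
  label_edge _ _ _ h := h.elim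
  label_dom _ _ _ h := h.elim

end LDAG

end CSIImitation

/-!
The law of a model factorizes along its graph, one mechanism per variable, and so does the law after
`do(π)` once edges from `PaPi` to the action are added. Two laws with the same mechanisms outside an
ancestral set agree as soon as they agree on that set.

The context `C` is ancestral and `do(π)` leaves its law alone. Given `C = c`, an edge that is absent
in the context `c` transmits nothing, so both laws are mixtures over `c` of the laws of a model on
the context-induced subgraph. The observed variables include `C`, hence the imitating policies for
the different `c` can be computed from the conditional observational distributions, and be combined
into a single policy.

Conversely, a model on the context-induced subgraph for `c` becomes a compatible model on the
labeled DAG when the context is constantly `c` and every other variable ignores the parents whose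
edges were deleted. Compatibility also constrains the mechanisms at values of the parents that do
not agree with `c`: there a mechanism follows the given model if compatibility alone identifies
these values with `c`, and is constant otherwise.
-/

namespace CSIImitation

section Overwrite

variable {ι : Type*} {α : ι → Type*} {S C : Set ι}

open Classical in
/-- The assignment `a` with the values of the variables in `S` replaced by those of `c`. -/
noncomputable def overwrite (S : Set ι) (c : ∀ i : S, α i) (a : ∀ i, α i) : ∀ i, α i :=
  fun i => if h : i ∈ S then c ⟨i, h⟩ else a i

theorem overwrite_of_mem (c : ∀ i : S, α i) (a : ∀ i, α i) {i : ι} (h : i ∈ S) :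
    overwrite S c a i = c ⟨i, h⟩ :=
  dif_pos h

theorem overwrite_of_notMem (c : ∀ i : S, α i) (a : ∀ i, α i) {i : ι} (h : i ∉ S) :
    overwrite S c a i = a i :=
  dif_neg h

/-- The counterpart of `overwrite` for partial assignments: the values `o` of the variables in `S`,
with those of the variables in `S ∩ C` replaced by the values `c`. -/
noncomputable def overwriteOn (S : Set ι) (c : ∀ i : C, α i) (o : ∀ i : S, α i) : ∀ i : S, α i :=
  overwrite (Subtype.val ⁻¹' C) (fun i => c ⟨i.1, i.2⟩) o

variable [∀ i, MeasurableSpace (α i)]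

theorem measurable_uncurry_overwrite :
    Measurable fun q : (∀ i : S, α i) × (∀ i, α i) => overwrite S q.1 q.2 := by
  refine measurable_pi_lambda _ fun i => ?_
  by_cases h : i ∈ S
  · simp only [overwrite_of_mem _ _ h]
    fun_prop
  · simp only [overwrite_of_notMem _ _ h]
    fun_prop

theorem measurable_overwrite (c : ∀ i : S, α i) : Measurable (overwrite S c) :=
  measurable_uncurry_overwrite.comp measurable_prodMk_left

theorem measurable_overwriteOn (S : Set ι) (c : ∀ i : C, α i) :
    Measurable (overwriteOn S c) :=
  measurable_overwrite _

end Overwrite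

section Measure

variable {Ω Ω' ι : Type*} [MeasurableSpace Ω] [MeasurableSpace Ω'] [MeasurableSpace ι]
  {μ : Measure Ω}

theorem cond_map {f : Ω → Ω'} (hf : Measurable f) {s : Set Ω'} (hs : MeasurableSet s) :
    (μ.map f)[|s] = μ[|f ⁻¹' s].map f := by
  rw [ProbabilityTheory.cond, ProbabilityTheory.cond, Measure.map_smul,
    Measure.restrict_map hf hs, Measure.map_apply hf hs]

theorem cond_preimage_singleton_of_eq_bind [MeasurableSingletonClass ι] [IsFiniteMeasure μ]
    {f : Ω → ι} (hf : Measurable f) {ν : ι → Measure Ω} (hν : Measurable ν)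
    (hμ : μ = μ.bind fun a => ν (f a)) (hsupp : ∀ i, ∀ᵐ a ∂ν i, f a = i) {i : ι}
    (hi : μ (f ⁻¹' {i}) ≠ 0) : μ[|f ⁻¹' {i}] = ν i := by
  have hfi : MeasurableSet (f ⁻¹' {i}) := hf (measurableSet_singleton i)
  ext A hA
  have fiber : ∀ a, ν (f a) (f ⁻¹' {i} ∩ A) = (f ⁻¹' {i}).indicator (fun _ => ν i A) a := by
    intro a
    by_cases ha : f a = i
    · rw [Set.indicator_of_mem (show a ∈ f ⁻¹' {i} from ha), ha]
      exact measure_congr ((hsupp i).mono fun b hb => propext ⟨And.right, And.intro hb⟩)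
    · rw [Set.indicator_of_notMem (show a ∉ f ⁻¹' {i} from ha)]
      exact measure_mono_null Set.inter_subset_left
        (measure_eq_zero_iff_ae_notMem.2 ((hsupp (f a)).mono fun b hb hbi => ha (hb ▸ hbi)))
  have joint : μ (f ⁻¹' {i} ∩ A) = ν i A * μ (f ⁻¹' {i}) := by
    nth_rw 1 [hμ]
    rw [Measure.bind_apply (hfi.inter hA) (by fun_prop), lintegral_congr fiber,
      lintegral_indicator_const hfi]
  rw [cond_apply hfi, joint, mul_comm, mul_assoc, ENNReal.mul_inv_cancel hi (measure_ne_top _ _),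
    mul_one]

theorem map_bind {κ : Ω → Measure Ω'} (hκ : Measurable κ) {f : Ω' → ι} (hf : Measurable f) :
    (μ.bind κ).map f = μ.bind fun a => (κ a).map f := by
  ext B hB
  have hκf : Measurable fun a => (κ a).map f := (Measure.measurable_map f hf).comp hκ
  rw [Measure.map_apply hf hB, Measure.bind_apply (hf hB) hκ.aemeasurable,
    Measure.bind_apply hB hκf.aemeasurable]
  exact lintegral_congr fun a => (Measure.map_apply hf hB).symm

theorem ae_eq_of_map_eq_dirac [MeasurableSingletonClass ι] {f : Ω → ι} (hf : Measurable f) {i : ι}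
    (h : μ.map f = Measure.dirac i) : ∀ᵐ a ∂μ, f a = i := by
  refine ae_of_ae_map (p := (· = i)) hf.aemeasurable ?_
  rw [h]
  exact (ae_dirac_iff (measurableSet_singleton i)).2 rfl

theorem ae_measure_preimage_singleton_ne_zero [Countable ι] [MeasurableSingletonClass ι]
    {f : Ω → ι} (hf : Measurable f) : ∀ᵐ a ∂μ, μ (f ⁻¹' {f a}) ≠ 0 := by
  refine ae_of_ae_map hf.aemeasurable (p := fun i => μ (f ⁻¹' {i}) ≠ 0) ?_
  simp only [ae_iff_of_countable, Measure.map_apply hf (measurableSet_singleton _), imp_self,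
    implies_true]

theorem lintegral_pi_resample {ι : Type*} [Fintype ι] [DecidableEq ι] {α : ι → Type*}
    [∀ i, MeasurableSpace (α i)] (P : ∀ i, Measure (α i)) [∀ i, SigmaFinite (P i)] (i : ι)
    [IsProbabilityMeasure (P i)] {F : (∀ j, α j) → ENNReal} (hF : Measurable F) :
    ∫⁻ e, F e ∂Measure.pi P = ∫⁻ e, ∫⁻ u, F (Function.update e i u) ∂P i ∂Measure.pi P := by
  have hm : Measurable fun q : (∀ j, α j) × α i => F (Function.update q.1 i q.2) :=
    hF.comp measurable_update'
  refine lintegral_eq_of_lmarginal_eq {i} hF hm.lintegral_prod_right' ?_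
  simp only [lmarginal_singleton, Function.update_idem, lintegral_const, measure_univ, mul_one]

end Measure

section Factorization

variable {V : Type*} {R R' : V → V → Prop} {S T C C' : Set V}

/-- A set of variables that contains the parents of its members, where `R p w` says that `p` is a
parent of `w`. -/
def Ancestral (R : V → V → Prop) (S : Set V) : Prop :=
  ∀ ⦃p w⦄, R p w → w ∈ S → p ∈ S

theorem Ancestral.insert {w : V} (hS : Ancestral R S) (hw : ∀ p, R p w → p ∈ S) :
    Ancestral R (insert w S) := by
  rintro p v hpv (rfl | hv)
  · exact Or.inr (hw p hpv)
  · exact Or.inr (hS hpv hv)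

theorem Ancestral.mono (hS : Ancestral R' S) (hR : R ≤ R') : Ancestral R S :=
  fun p w hpw => hS (hR p w hpw)

variable {D : V → Type*} [∀ w, MeasurableSpace (D w)] {μ ν ρ : Measure (∀ w, D w)}

/-- The measures `μ` and `ν` have the same marginal on `S`, expressed through the integrals of the
functions of the variables in `S`. -/
def AgreesOn (S : Set V) (μ ν : Measure (∀ w, D w)) : Prop :=
  ∀ ⦃h : (∀ w, D w) → ENNReal⦄, Measurable h → DependsOn h S → ∫⁻ a, h a ∂μ = ∫⁻ a, h a ∂ν

theorem AgreesOn.map_eq {β : Type*} [MeasurableSpace β] {f : (∀ w, D w) → β} (h : AgreesOn S μ ν)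
    (hf : Measurable f) (hfS : DependsOn f S) : μ.map f = ν.map f := by
  refine Measure.ext_of_lintegral _ fun g hg => ?_
  rw [lintegral_map hg hf, lintegral_map hg hf]
  exact h (hg.comp hf) fun a b hab => congrArg g (hfS hab)

theorem agreesOn_univ_iff : AgreesOn Set.univ μ ν ↔ μ = ν :=
  ⟨fun h => Measure.ext_of_lintegral _ fun g hg => h hg (dependsOn_univ g),
    fun h _ _ _ => by rw [h]⟩

variable [DecidableEq V] {κ κ' : ∀ w, Kernel (∀ v, D v) (D w)}

/-- Under `μ`, each variable `w ∉ C` has the conditional law `κ w` given any ancestral set of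
variables that contains `C` and the parents of `w`, but not `w` itself. This is the factorization
of `μ` along the graph `R`, conditionally on the variables in `C`. -/
def FactorizesOutside (R : V → V → Prop) (C : Set V) (κ : ∀ w, Kernel (∀ v, D v) (D w))
    (μ : Measure (∀ w, D w)) : Prop :=
  ∀ ⦃S⦄, C ⊆ S → Ancestral R S → ∀ ⦃w⦄, w ∉ S → (∀ p, R p w → p ∈ S) →
    ∀ ⦃h : (∀ w, D w) → ENNReal⦄, Measurable h → DependsOn h (insert w S) →
      ∫⁻ a, h a ∂μ = ∫⁻ a, ∫⁻ y, h (Function.update a w y) ∂κ w a ∂μ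

theorem FactorizesOutside.mono (hμ : FactorizesOutside R C κ μ) (hR : R ≤ R') (hC : C ⊆ C') :
    FactorizesOutside R' C' κ μ :=
  fun _ hCS hS w hw hpa => hμ (hC.trans hCS) (hS.mono hR) hw fun p hp => hpa p (hR p w hp)

theorem FactorizesOutside.congr (hμ : FactorizesOutside R C κ μ)
    (hκ : ∀ w ∉ C, ∀ᵐ a ∂μ, κ w a = κ' w a) : FactorizesOutside R C κ' μ := by
  intro S hCS hS w hw hpa h hh hhS
  rw [hμ hCS hS hw hpa hh hhS]
  refine lintegral_congr_ae ((hκ w fun hwC => hw (hCS hwC)).mono fun a ha => ?_)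
  simp only [ha]

theorem measurable_lintegral_update {w : V} (η : Kernel (∀ v, D v) (D w)) [IsSFiniteKernel η]
    {h : (∀ v, D v) → ENNReal} (hh : Measurable h) :
    Measurable fun a => ∫⁻ y, h (Function.update a w y) ∂η a :=
  (hh.comp measurable_update').lintegral_kernel_prod_right'

theorem dependsOn_lintegral_update {w : V} {η : Kernel (∀ v, D v) (D w)} (hη : DependsOn η S)
    {h : (∀ v, D v) → ENNReal} (hh : DependsOn h (insert w S)) :
    DependsOn (fun a => ∫⁻ y, h (Function.update a w y) ∂η a) S := by
  intro a b hab
  simp only [hη hab]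
  refine lintegral_congr fun y => hh fun v hv => ?_
  by_cases hvw : v = w
  · subst hvw
    simp only [Function.update_self]
  · simp only [Function.update_of_ne hvw, hab v (hv.resolve_left hvw)]

variable [∀ w, IsSFiniteKernel (κ w)]

theorem FactorizesOutside.bind {Ω : Type*} [MeasurableSpace Ω] {ρ : Measure Ω}
    {ν : Ω → Measure (∀ w, D w)} (hν : Measurable ν) (h : ∀ a, FactorizesOutside R C κ (ν a)) :
    FactorizesOutside R C κ (ρ.bind ν) := by
  intro S hCS hS w hw hpa g hg hgS
  rw [Measure.lintegral_bind hν.aemeasurable hg.aemeasurable,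
    Measure.lintegral_bind hν.aemeasurable (measurable_lintegral_update (κ w) hg).aemeasurable]
  exact lintegral_congr fun a => h a hCS hS hw hpa hg hgS

theorem FactorizesOutside.eq_of_agreesOn [Finite V] (hR : WellFounded R) (hC : Ancestral R C)
    (hκ : ∀ w, DependsOn (κ w) {p | R p w}) (hμ : FactorizesOutside R C κ μ)
    (hν : FactorizesOutside R C κ ν) (h : AgreesOn C μ ν) : μ = ν := by
  obtain ⟨S, hCS, ⟨hS, hagree⟩, hmax⟩ :
      ∃ S, C ≤ S ∧ Maximal (fun S => Ancestral R S ∧ AgreesOn S μ ν) S :=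
    Finite.exists_le_maximal ⟨hC, h⟩
  suffices hSuniv : S = Set.univ from agreesOn_univ_iff.1 (hSuniv ▸ hagree)
  by_contra hne
  obtain ⟨w, hw, hmin⟩ := hR.has_min Sᶜ (Set.nonempty_compl.2 hne)
  have hpa : ∀ p, R p w → p ∈ S := fun p hp => not_not.1 fun hpS => hmin p hpS hp
  have hagree' : AgreesOn (insert w S) μ ν := by
    intro g hg hgS
    rw [hμ hCS hS hw hpa hg hgS, hν hCS hS hw hpa hg hgS]
    exact hagree (measurable_lintegral_update (κ w) hg)
      (dependsOn_lintegral_update ((hκ w).mono hpa) hgS)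
  exact hw (hmax ⟨hS.insert hpa, hagree'⟩ (Set.subset_insert w S) (Set.mem_insert w S))

theorem FactorizesOutside.eq_bind [Finite V] (hR : WellFounded R) (hC : Ancestral R C)
    (hκ : ∀ w, DependsOn (κ w) {p | R p w}) (hμ : FactorizesOutside R C κ μ)
    {ν : (∀ w : C, D w) → Measure (∀ w, D w)} [∀ c, IsProbabilityMeasure (ν c)]
    (hνm : Measurable ν) (hν : ∀ c, FactorizesOutside R C κ (ν c))
    (hsupp : ∀ c, ∀ᵐ a ∂ν c, C.domRestrict a = c) (h : AgreesOn C μ ρ) :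
    μ = ρ.bind fun a => ν (C.domRestrict a) := by
  have hνC : Measurable fun a => ν (C.domRestrict a) := hνm.comp (Set.measurable_restrict C)
  refine hμ.eq_of_agreesOn hR hC hκ (FactorizesOutside.bind hνC fun a => hν _) ?_
  intro g hg hgC
  rw [h hg hgC, Measure.lintegral_bind hνC.aemeasurable hg.aemeasurable]
  refine lintegral_congr fun a => ?_
  have hga : ∀ᵐ b ∂ν (C.domRestrict a), g b = g a :=
    (hsupp _).mono fun b hb => hgC fun w hw => congrFun hb ⟨w, hw⟩
  rw [lintegral_congr_ae hga, lintegral_const, measure_univ, mul_one]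

end Factorization

theorem kernel_id_prod_map_apply {Ω Ω' Ω'' : Type*} [MeasurableSpace Ω] [MeasurableSpace Ω']
    [MeasurableSpace Ω''] (η : Kernel Ω Ω') [IsSFiniteKernel η] {g : Ω × Ω' → Ω''}
    (hg : Measurable g) (a : Ω) :
    (Kernel.id ×ₖ η).map g a = (η a).map fun b => g (a, b) := by
  rw [Kernel.map_apply _ hg, Kernel.prod_apply, Kernel.id_apply, Measure.dirac_prod,
    Measure.map_map hg measurable_prodMk_left]
  rfl

instance isMarkovKernel_policy {V : Type v} {D : V → Type u} [∀ w, MeasurableSpace (D w)] {X : V}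
    {PaPi : Set V} (π : Policy D X PaPi) : IsMarkovKernel π.1 :=
  π.2

namespace LDAG

variable {V : Type v} {D : V → Type u} {G : LDAG D} {i j w X : V} {PaPi : Set V}

theorem mem_context_of_label {l : Realization D} (hl : l ∈ G.label i j) (hw : w ∈ l.dom) :
    w ∈ G.context :=
  ⟨i, j, l, hl, hw⟩

theorem ancestral_compl_De (X : V) : Ancestral G.edge (G.De X)ᶜ :=
  fun _ _ hpw hw hp => hw (Relation.ReflTransGen.tail hp hpw)

theorem self_mem_De (X : V) : X ∈ G.De X :=
  Relation.ReflTransGen.refl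

theorem notMem_context (hPaPi : Disjoint PaPi (G.De X)) (hcontext : G.context ⊆ PaPi) :
    X ∉ G.context :=
  fun hX => hPaPi.notMem_of_mem_left (hcontext hX) (self_mem_De X)

/-- The edges of `G` together with edges from the variables in `PaPi` to `X`. They carry both the
observational law and the law after `do(π)` of a model on `G`. -/
def policyEdge (G : LDAG D) (X : V) (PaPi : Set V) (p w : V) : Prop :=
  G.edge p w ∨ p ∈ PaPi ∧ w = X

theorem edge_le_policyEdge : G.edge ≤ G.policyEdge X PaPi :=
  fun _ _ => Or.inl

theorem policyEdge_wf [Finite V] (hPaPi : Disjoint PaPi (G.De X)) :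
    WellFounded (G.policyEdge X PaPi) := by
  rw [WellFounded.wellFounded_iff_has_min]
  intro T hT
  by_cases hne : (T \ G.De X).Nonempty
  · obtain ⟨m, hm, hmin⟩ := G.edge_wf.has_min _ hne
    refine ⟨m, hm.1, ?_⟩
    rintro p hp (hpm | ⟨-, rfl⟩)
    · exact hmin p ⟨hp, ancestral_compl_De X hpm hm.2⟩ hpm
    · exact hm.2 (self_mem_De m)
  · obtain ⟨m, hm, hmin⟩ := G.edge_wf.has_min T hT
    refine ⟨m, hm, ?_⟩
    rintro p hp (hpm | ⟨hpPi, -⟩)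
    · exact hmin p hp hpm
    · exact hne ⟨p, hp, hPaPi.notMem_of_mem_left hpPi⟩

end LDAG

namespace SCM

variable {V : Type v} {D : V → Type u} [∀ w, MeasurableSpace (D w)] {G : LDAG D} (M : SCM G)
  {X w : V} {S PaPi : Set V}

section Solution

variable [Finite V] (x : D X) (e : ∀ w, M.U w)

theorem sol_apply (w : V) : M.sol e w = M.f w (fun p => M.sol e p) (e w) := by
  rw [sol, G.edge_wf.fix_eq]

theorem solDo_self : M.solDo X x e X = x := by
  rw [solDo, G.edge_wf.fix_eq, dif_pos rfl]

theorem solDo_of_ne (hw : w ≠ X) :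
    M.solDo X x e w = M.f w (fun p => M.solDo X x e p) (e w) := by
  rw [solDo, G.edge_wf.fix_eq, dif_neg hw]

variable {x e}

theorem measurable_sol : Measurable M.sol := by
  refine measurable_pi_lambda _ fun w => ?_
  induction w using G.edge_wf.induction with
  | _ w ih =>
    simp only [M.sol_apply _ w]
    exact (M.measurable_f w).comp
      ((measurable_pi_lambda _ fun p : G.Pa w => ih p p.2).prodMk (measurable_pi_apply w))

theorem measurable_uncurry_solDo : Measurable fun q : (∀ w, M.U w) × D X => M.solDo X q.2 q.1 := by
  refine measurable_pi_lambda _ fun w => ?_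
  induction w using G.edge_wf.induction with
  | _ w ih =>
    obtain rfl | hw := eq_or_ne w X
    · simp only [solDo_self]
      exact measurable_snd
    · simp only [M.solDo_of_ne _ _ hw]
      exact (M.measurable_f w).comp ((measurable_pi_lambda _ fun p : G.Pa w => ih p p.2).prodMk
        ((measurable_pi_apply w).comp measurable_fst))

theorem measurable_solDo (e : ∀ w, M.U w) : Measurable fun x => M.solDo X x e :=
  M.measurable_uncurry_solDo.comp measurable_prodMk_left

theorem dependsOn_sol (hS : Ancestral G.edge S) (hw : w ∈ S) :
    DependsOn (fun e => M.sol e w) S := by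
  intro e e' he
  induction w using G.edge_wf.induction with
  | _ w ih =>
    simp only [M.sol_apply _ w, he w hw]
    exact congrArg₂ _ (funext fun p => ih p p.2 (hS p.2 hw)) rfl

theorem dependsOn_solDo (x : D X) (hS : Ancestral G.edge S) (hw : w ∈ S) :
    DependsOn (fun e => M.solDo X x e w) S := by
  intro e e' he
  induction w using G.edge_wf.induction with
  | _ w ih =>
    obtain rfl | hwX := eq_or_ne w X
    · simp only [solDo_self]
    · simp only [M.solDo_of_ne _ _ hwX, he w hw]
      exact congrArg₂ _ (funext fun p => ih p p.2 (hS p.2 hw)) rfl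

theorem solDo_eq_sol (hS : Ancestral G.edge S) (hX : X ∉ S) (hw : w ∈ S) :
    M.solDo X x e w = M.sol e w := by
  induction w using G.edge_wf.induction with
  | _ w ih =>
    rw [M.solDo_of_ne x e (ne_of_mem_of_not_mem hw hX), M.sol_apply e w]
    exact congrArg₂ _ (funext fun p => ih p p.2 (hS p.2 hw)) rfl

variable [DecidableEq V]

theorem sol_update (hS : Ancestral G.edge S) (hw : w ∉ S) (hpa : G.Pa w ⊆ S) (u : M.U w) {v : V}
    (hv : v ∈ insert w S) : M.sol (Function.update e w u) v =
      Function.update (M.sol e) w (M.f w ((G.Pa w).domRestrict (M.sol e)) u) v := by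
  have off : ∀ v ∈ S, M.sol (Function.update e w u) v = M.sol e v := fun v hv =>
    M.dependsOn_sol hS hv fun i hi => Function.update_of_ne (ne_of_mem_of_not_mem hi hw) u e
  obtain rfl | hv := hv
  · rw [sol_apply, Function.update_self, Function.update_self]
    exact congrArg₂ _ (funext fun p => off p (hpa p.2)) rfl
  · rw [Function.update_of_ne (ne_of_mem_of_not_mem hv hw), off v hv]

theorem solDo_update (hS : Ancestral G.edge S) (hw : w ∉ S) (hpa : G.Pa w ⊆ S) (hwX : w ≠ X)
    (u : M.U w) {v : V} (hv : v ∈ insert w S) : M.solDo X x (Function.update e w u) v =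
      Function.update (M.solDo X x e) w (M.f w ((G.Pa w).domRestrict (M.solDo X x e)) u) v := by
  have off : ∀ v ∈ S, M.solDo X x (Function.update e w u) v = M.solDo X x e v := fun v hv =>
    M.dependsOn_solDo x hS hv fun i hi => Function.update_of_ne (ne_of_mem_of_not_mem hi hw) u e
  obtain rfl | hv := hv
  · rw [M.solDo_of_ne _ _ hwX, Function.update_self, Function.update_self]
    exact congrArg₂ _ (funext fun p => off p (hpa p.2)) rfl
  · rw [Function.update_of_ne (ne_of_mem_of_not_mem hv hw), off v hv]

end Solution

section Law

variable (π : Policy D X PaPi) {h : (∀ w, D w) → ENNReal}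

section Finite

variable [Finite V]

/-- The law of the action under `do(π)` as a function of the exogenous variables. -/
noncomputable def actionKernel : Kernel (∀ w, M.U w) (D X) :=
  π.1.comap (PaPi.domRestrict ∘ M.sol) ((Set.measurable_restrict PaPi).comp M.measurable_sol)

theorem actionKernel_apply (e : ∀ w, M.U w) :
    M.actionKernel π e = π.1 (PaPi.domRestrict (M.sol e)) :=
  rfl

instance isMarkovKernel_actionKernel : IsMarkovKernel (M.actionKernel π) :=
  Kernel.IsMarkovKernel.comap _ _

theorem measurable_map_solDo :
    Measurable fun e => (π.1 fun w => M.sol e w).map fun x => M.solDo X x e := by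
  convert ((Kernel.id ×ₖ M.actionKernel π).map fun q => M.solDo X q.2 q.1).measurable using 2 with e
  exact (kernel_id_prod_map_apply (M.actionKernel π) M.measurable_uncurry_solDo e).symm

theorem measurable_lintegral_solDo (hh : Measurable h) :
    Measurable fun e => ∫⁻ x, h (M.solDo X x e) ∂M.actionKernel π e :=
  (hh.comp M.measurable_uncurry_solDo).lintegral_kernel_prod_right'

end Finite

variable [Fintype V]

instance isProbabilityMeasure_noise : IsProbabilityMeasure M.noise :=
  inferInstanceAs (IsProbabilityMeasure (Measure.pi M.P))

instance isProbabilityMeasure_law : IsProbabilityMeasure M.law :=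
  Measure.isProbabilityMeasure_map M.measurable_sol.aemeasurable

instance isProbabilityMeasure_doPolicy : IsProbabilityMeasure (M.doPolicy π) :=
  isProbabilityMeasure_bind (M.measurable_map_solDo π).aemeasurable
    (.of_forall fun e => Measure.isProbabilityMeasure_map
      (M.measurable_solDo e).aemeasurable)

theorem lintegral_law (hh : Measurable h) :
    ∫⁻ a, h a ∂M.law = ∫⁻ e, h (M.sol e) ∂M.noise :=
  lintegral_map hh M.measurable_sol

theorem lintegral_doPolicy (hh : Measurable h) :
    ∫⁻ a, h a ∂M.doPolicy π = ∫⁻ e, ∫⁻ x, h (M.solDo X x e) ∂M.actionKernel π e ∂M.noise := by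
  rw [doPolicy, Measure.lintegral_bind (M.measurable_map_solDo π).aemeasurable hh.aemeasurable]
  exact lintegral_congr fun e => lintegral_map hh (M.measurable_solDo e)

theorem agreesOn_doPolicy_law (hS : Ancestral G.edge S) (hX : X ∉ S) :
    AgreesOn S (M.doPolicy π) M.law := by
  intro h hh hhS
  rw [M.lintegral_doPolicy π hh, M.lintegral_law hh]
  refine lintegral_congr fun e => ?_
  have hsol : ∀ x, h (M.solDo X x e) = h (M.sol e) :=
    fun x => hhS fun w hw => M.solDo_eq_sol hS hX hw
  simp only [hsol, lintegral_const, measure_univ, mul_one]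

end Law

section Kernel

/-- The mechanism of `w` as a Markov kernel from the assignments of values to all variables. -/
noncomputable def kernel (w : V) : Kernel (∀ v, D v) (D w) :=
  (Kernel.id ×ₖ Kernel.const _ (M.P w)).map fun q => M.f w ((G.Pa w).domRestrict q.1) q.2

theorem measurable_f_domRestrict (w : V) :
    Measurable fun q : (∀ v, D v) × M.U w => M.f w ((G.Pa w).domRestrict q.1) q.2 :=
  (M.measurable_f w).comp
    (((Set.measurable_restrict (G.Pa w)).comp measurable_fst).prodMk measurable_snd)

instance isMarkovKernel_kernel (w : V) : IsMarkovKernel (M.kernel w) :=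
  Kernel.IsMarkovKernel.map _ (M.measurable_f_domRestrict w)

theorem kernel_apply (w : V) (a : ∀ v, D v) :
    M.kernel w a = M.mechanism w ((G.Pa w).domRestrict a) :=
  kernel_id_prod_map_apply _ (M.measurable_f_domRestrict w) a

theorem dependsOn_kernel (w : V) : DependsOn (M.kernel w) (G.Pa w) := fun a b hab => by
  rw [kernel_apply, kernel_apply, Set.dependsOn_domRestrict _ hab]

theorem lintegral_kernel {g : D w → ENNReal} (hg : Measurable g) (a : ∀ v, D v) :
    ∫⁻ y, g y ∂M.kernel w a = ∫⁻ u, g (M.f w ((G.Pa w).domRestrict a) u) ∂M.P w := by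
  rw [kernel_apply]
  exact lintegral_map hg ((M.measurable_f_domRestrict w).comp measurable_prodMk_left)

variable [DecidableEq V] (π : Policy D X PaPi)

/-- The mechanisms after the intervention `do(π)`. -/
noncomputable def kernelDo : ∀ w, Kernel (∀ v, D v) (D w) :=
  Function.update M.kernel X (π.1.comap PaPi.domRestrict (Set.measurable_restrict PaPi))

theorem kernelDo_self_apply (a : ∀ v, D v) :
    M.kernelDo π X a = π.1 (PaPi.domRestrict a) := by
  rw [kernelDo, Function.update_self, Kernel.comap_apply]

theorem kernelDo_of_ne (hw : w ≠ X) : M.kernelDo π w = M.kernel w :=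
  Function.update_of_ne hw _ _

instance isMarkovKernel_kernelDo (w : V) : IsMarkovKernel (M.kernelDo π w) := by
  obtain rfl | hw := eq_or_ne w X
  · exact ⟨fun a => M.kernelDo_self_apply π a ▸ inferInstance⟩
  · exact M.kernelDo_of_ne π hw ▸ inferInstance

theorem dependsOn_kernelDo (w : V) :
    DependsOn (M.kernelDo π w) {p | G.policyEdge X PaPi p w} := by
  intro a b hab
  obtain rfl | hw := eq_or_ne w X
  · rw [kernelDo_self_apply, kernelDo_self_apply,
      Set.dependsOn_domRestrict PaPi fun p hp => hab p (Or.inr ⟨hp, rfl⟩)]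
  · rw [M.kernelDo_of_ne π hw]
    exact M.dependsOn_kernel w fun p hp => hab p (Or.inl hp)

variable [Fintype V]

theorem factorizesOutside_law : FactorizesOutside G.edge ∅ M.kernel M.law := by
  intro S _ hS w hw hpa h hh hhS
  rw [M.lintegral_law hh, M.lintegral_law (measurable_lintegral_update (M.kernel w) hh), noise]
  refine (lintegral_pi_resample M.P w (hh.comp M.measurable_sol)).trans
    (lintegral_congr fun e => ?_)
  exact (lintegral_congr fun u => hhS fun v hv => M.sol_update hS hw hpa u hv).trans
    (M.lintegral_kernel (hh.comp (measurable_update _)) _).symm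

theorem lintegral_doPolicy_insert_self (hS : Ancestral G.edge S) (hX : X ∉ S) (hPaPi : PaPi ⊆ S)
    {h : (∀ v, D v) → ENNReal} (hh : Measurable h) (hhS : DependsOn h (insert X S)) :
    ∫⁻ a, h a ∂M.doPolicy π =
      ∫⁻ a, ∫⁻ y, h (Function.update a X y) ∂M.kernelDo π X a ∂M.doPolicy π := by
  have hκ : DependsOn (M.kernelDo π X) S := fun a b hab => by
    rw [kernelDo_self_apply, kernelDo_self_apply,
      Set.dependsOn_domRestrict PaPi fun p hp => hab p (hPaPi hp)]
  have hm := measurable_lintegral_update (M.kernelDo π X) hh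
  rw [M.agreesOn_doPolicy_law π hS hX hm (dependsOn_lintegral_update hκ hhS),
    M.lintegral_law hm, M.lintegral_doPolicy π hh]
  refine lintegral_congr fun e => ?_
  rw [kernelDo_self_apply, actionKernel_apply]
  refine lintegral_congr fun x => hhS fun v hv => ?_
  obtain rfl | hv := hv
  · rw [solDo_self, Function.update_self]
  · rw [Function.update_of_ne (ne_of_mem_of_not_mem hv hX), M.solDo_eq_sol hS hX hv]

theorem lintegral_doPolicy_insert_of_ne (hS : Ancestral G.edge S) (hPaPi : PaPi ⊆ S) (hw : w ∉ S)
    (hpa : G.Pa w ⊆ S) (hwX : w ≠ X) {h : (∀ v, D v) → ENNReal} (hh : Measurable h)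
    (hhS : DependsOn h (insert w S)) :
    ∫⁻ a, h a ∂M.doPolicy π =
      ∫⁻ a, ∫⁻ y, h (Function.update a w y) ∂M.kernel w a ∂M.doPolicy π := by
  have hm := measurable_lintegral_update (M.kernel w) hh
  have action_eq : ∀ e u, M.actionKernel π (Function.update e w u) = M.actionKernel π e := by
    intro e u
    rw [actionKernel_apply, actionKernel_apply]
    exact congrArg π.1 (funext fun p => M.dependsOn_sol hS (hPaPi p.2) fun i hi =>
      Function.update_of_ne (ne_of_mem_of_not_mem hi hw) u e)
  have hmeas : ∀ e, Measurable fun q : M.U w × D X =>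
      h (M.solDo X q.2 (Function.update e w q.1)) := fun e =>
    hh.comp (M.measurable_uncurry_solDo.comp (((measurable_update e).comp measurable_fst).prodMk
      measurable_snd))
  rw [M.lintegral_doPolicy π hh, M.lintegral_doPolicy π hm, noise,
    lintegral_pi_resample M.P w (M.measurable_lintegral_solDo π hh)]
  refine lintegral_congr fun e => ?_
  calc ∫⁻ u, ∫⁻ x, h (M.solDo X x (Function.update e w u))
        ∂M.actionKernel π (Function.update e w u) ∂M.P w
      = ∫⁻ u, ∫⁻ x, h (M.solDo X x (Function.update e w u)) ∂M.actionKernel π e ∂M.P w := by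
        simp only [action_eq]
    _ = ∫⁻ x, ∫⁻ u, h (M.solDo X x (Function.update e w u)) ∂M.P w ∂M.actionKernel π e :=
        lintegral_lintegral_swap (hmeas e).aemeasurable
    _ = ∫⁻ x, ∫⁻ y, h (Function.update (M.solDo X x e) w y) ∂M.kernel w (M.solDo X x e)
          ∂M.actionKernel π e := by
        refine lintegral_congr fun x => ?_
        exact (lintegral_congr fun u => hhS fun v hv =>
          M.solDo_update hS hw hpa hwX u hv).trans
            (M.lintegral_kernel (hh.comp (measurable_update _)) _).symm

theorem factorizesOutside_doPolicy :
    FactorizesOutside (G.policyEdge X PaPi) ∅ (M.kernelDo π) (M.doPolicy π) := by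
  intro S _ hS w hw hpa h hh hhS
  have hSG : Ancestral G.edge S := hS.mono LDAG.edge_le_policyEdge
  have hpaG : G.Pa w ⊆ S := fun p hp => hpa p (Or.inl hp)
  obtain rfl | hwX := eq_or_ne w X
  · exact M.lintegral_doPolicy_insert_self π hSG hw (fun p hp => hpa p (Or.inr ⟨hp, rfl⟩)) hh hhS
  rw [M.kernelDo_of_ne π hwX]
  by_cases hX : X ∈ S
  · exact M.lintegral_doPolicy_insert_of_ne π hSG (fun p hp => hS (Or.inr ⟨hp, rfl⟩) hX) hw hpaG
      hwX hh hhS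
  · rw [M.agreesOn_doPolicy_law π (hSG.insert hpaG) (by simp [hX, hwX.symm]) hh hhS,
      M.factorizesOutside_law (Set.empty_subset S) hSG hw hpaG hh hhS]
    exact (M.agreesOn_doPolicy_law π hSG hX (measurable_lintegral_update (M.kernel w) hh)
      (dependsOn_lintegral_update ((M.dependsOn_kernel w).mono hpaG) hhS)).symm

end Kernel

end SCM

section Context

variable {V : Type v} {D : V → Type u}

/-- The partial assignments `q` and `r` have the same values at their common variables. -/
def Agree {S T : Set V} (q : ∀ w : S, D w) (r : ∀ w : T, D w) : Prop :=
  ∀ (w : S) (h : (w : V) ∈ T), q w = r ⟨w, h⟩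

variable [∀ w, MeasurableSpace (D w)] {G : LDAG D} {c : ∀ w : G.context, D w} {i w X Y : V}
  {PaPi O : Set V}

namespace LDAG

theorem edge_induced_le : (G.induced c).edge ≤ G.edge :=
  fun _ _ h => h.1

theorem ancestral_context_induced : Ancestral (G.induced c).edge G.context :=
  fun _ _ h hw => absurd hw h.2.2.1

theorem Absent.mechanism_eq (h : G.Absent c i w) {M : SCM G} (hM : M.Compatible)
    {q q' : ∀ p : G.Pa w, D p} (hq : Agree q c) (hq' : Agree q' c)
    (hne : ∀ p : G.Pa w, (p : V) ≠ i → q p = q' p) : M.mechanism w q = M.mechanism w q' := by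
  obtain ⟨l, hl, hdom, hval⟩ := h
  exact hl.2 M hM q q' (fun p hp => (hq p (hdom hp)).trans (hval ⟨p, hp⟩).symm)
    (fun p hp => (hq' p (hdom hp)).trans (hval ⟨p, hp⟩).symm) hne

end LDAG

namespace SCM

theorem mechanism_eq_of_absent [Finite V] {M : SCM G} (hM : M.Compatible)
    {q q' : ∀ p : G.Pa w, D p} (hq : Agree q c) (hq' : Agree q' c)
    (h : ∀ p, q p ≠ q' p → G.Absent c p w) : M.mechanism w q = M.mechanism w q' := by
  classical
  suffices ∀ T : Set (G.Pa w), ∀ q, Agree q c → (∀ p, q p ≠ q' p → G.Absent c p w) →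
      (∀ p ∉ T, q p = q' p) → M.mechanism w q = M.mechanism w q' from
    this Set.univ q hq h fun p hp => absurd trivial hp
  intro T
  induction T, T.toFinite using Set.Finite.induction_on with
  | empty => exact fun q _ _ hqq' => congrArg _ (funext fun p => hqq' p (Set.notMem_empty p))
  | @insert t T _ _ ih =>
    intro q hq h hqq'
    have off : ∀ p ≠ t, q p = Function.update q t (q' t) p := fun p hp =>
      (Function.update_of_ne hp _ _).symm
    have update_agree : Agree (Function.update q t (q' t)) c := by
      intro p hp
      obtain rfl | hpt := eq_or_ne p t
      · rw [Function.update_self, hq' p hp]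
      · rw [← off p hpt, hq p hp]
    have move_t : M.mechanism w q = M.mechanism w (Function.update q t (q' t)) := by
      by_cases ht : q t = q' t
      · rw [← ht, Function.update_eq_self]
      · exact (h t ht).mechanism_eq hM hq update_agree fun p hp =>
          off p (ne_of_apply_ne Subtype.val hp)
    refine move_t.trans (ih _ update_agree (fun p hp => ?_) fun p hp => ?_)
    all_goals obtain rfl | hpt := eq_or_ne p t
    · exact absurd (Function.update_self _ _ _) hp
    · exact h p (off p hpt ▸ hp)
    · exact Function.update_self _ _ _
    · rw [← off p hpt]
      exact hqq' p fun hpT => hpT.elim hpt hp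

variable [∀ w, Nonempty (D w)] (M : SCM G) (c)

open Classical in
/-- The model on the context-induced subgraph that is obtained from `M` by setting the context
variables to `c`, and the parents along deleted edges to arbitrary values. -/
noncomputable def fixContext : SCM (G.induced c) where
  U := M.U
  mU := M.mU
  P := M.P
  prob := M.prob
  f w pa u := if h : w ∈ G.context then c ⟨w, h⟩ else
    M.f w (fun p => overwrite G.context c
      (overwrite ((G.induced c).Pa w) pa fun _ => Classical.arbitrary _) p) u
  measurable_f w := by
    by_cases h : w ∈ G.context
    · simp only [h, dif_pos]
      exact measurable_const
    · simp only [h, dif_neg, not_false_iff]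
      have hpa : Measurable fun q : (∀ p : (G.induced c).Pa w, D p) × M.U w => overwrite G.context c
          (overwrite ((G.induced c).Pa w) q.1 fun _ => Classical.arbitrary _) :=
        measurable_uncurry_overwrite.comp (measurable_const.prodMk
          (measurable_uncurry_overwrite.comp (measurable_fst.prodMk measurable_const)))
      exact (M.measurable_f_domRestrict w).comp (hpa.prodMk measurable_snd)

theorem compatible_fixContext : (M.fixContext c).Compatible :=
  fun _ _ _ hl => hl.elim

variable {M} in
theorem kernel_fixContext [Finite V] (hM : M.Compatible) (hw : w ∉ G.context) {a : ∀ v, D v}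
    (ha : G.context.domRestrict a = c) : (M.fixContext c).kernel w a = M.kernel w a := by
  have mechanism_eq : (M.fixContext c).mechanism w ((G.induced c).Pa w |>.domRestrict a) =
      M.mechanism w ((G.Pa w).domRestrict (overwrite G.context c (overwrite ((G.induced c).Pa w)
        ((G.induced c).Pa w |>.domRestrict a) fun _ => Classical.arbitrary _))) := by
    simp only [mechanism, fixContext, hw, dif_neg, not_false_iff]
    rfl
  rw [kernel_apply, kernel_apply, mechanism_eq]
  refine mechanism_eq_of_absent hM (fun p hp => overwrite_of_mem _ _ hp)
    (fun p hp => congrFun ha ⟨p, hp⟩) fun p hne => ?_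
  by_contra habs
  refine hne ?_
  by_cases hp : (p : V) ∈ G.context
  · exact (overwrite_of_mem _ _ hp).trans (congrFun ha ⟨p, hp⟩).symm
  · have hpw : (p : V) ∈ (G.induced c).Pa w := ⟨p.2, hp, hw, habs⟩
    exact (overwrite_of_notMem _ _ hp).trans (overwrite_of_mem _ _ hpw)

theorem domRestrict_sol_fixContext [Finite V] (e : ∀ w, (M.fixContext c).U w) :
    G.context.domRestrict ((M.fixContext c).sol e) = c := by
  funext v
  rw [Set.domRestrict_apply, sol_apply]
  exact dif_pos v.2

variable [Fintype V] (π : Policy D X PaPi)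

theorem map_domRestrict_law_fixContext :
    (M.fixContext c).law.map G.context.domRestrict = Measure.dirac c := by
  rw [law, Measure.map_map (Set.measurable_restrict _) (measurable_sol _)]
  simp only [Function.comp_def, domRestrict_sol_fixContext, Measure.map_const, measure_univ,
    one_smul]

theorem domRestrict_ae_eq_law_fixContext [∀ w : G.context, MeasurableSingletonClass (D w)] :
    ∀ᵐ a ∂(M.fixContext c).law, G.context.domRestrict a = c :=
  ae_eq_of_map_eq_dirac (Set.measurable_restrict _) (M.map_domRestrict_law_fixContext c)

theorem domRestrict_ae_eq_doPolicy_fixContext [∀ w : G.context, MeasurableSingletonClass (D w)]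
    (hX : X ∉ G.context) :
    ∀ᵐ a ∂(M.fixContext c).doPolicy π, G.context.domRestrict a = c := by
  refine ae_eq_of_map_eq_dirac (Set.measurable_restrict _) ?_
  rw [← M.map_domRestrict_law_fixContext c]
  exact ((M.fixContext c).agreesOn_doPolicy_law π LDAG.ancestral_context_induced hX).map_eq
    (Set.measurable_restrict _) (Set.dependsOn_domRestrict _)

variable {M} [∀ w : G.context, Countable (D w)] [∀ w : G.context, DiscreteMeasurableSpace (D w)]

theorem law_eq_bind_fixContext (hM : M.Compatible) (hparents : Ancestral G.edge G.context) :
    M.law = M.law.bind fun a => (M.fixContext (G.context.domRestrict a)).law := by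
  classical
  have hfactor : ∀ c, FactorizesOutside G.edge G.context M.kernel (M.fixContext c).law := fun c =>
    ((M.fixContext c).factorizesOutside_law.mono LDAG.edge_induced_le (Set.empty_subset _)).congr
      fun w hw => (M.domRestrict_ae_eq_law_fixContext c).mono fun a ha =>
        kernel_fixContext c hM hw ha
  exact (M.factorizesOutside_law.mono le_rfl (Set.empty_subset _)).eq_bind G.edge_wf hparents
    M.dependsOn_kernel (ν := fun c => (M.fixContext c).law) .of_discrete hfactor
    M.domRestrict_ae_eq_law_fixContext fun _ _ _ => rfl

theorem doPolicy_eq_bind_fixContext (hM : M.Compatible) (hPaPi : Disjoint PaPi (G.De X))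
    (hcontext : G.context ⊆ PaPi) (hparents : Ancestral G.edge G.context) :
    M.doPolicy π = M.law.bind fun a => (M.fixContext (G.context.domRestrict a)).doPolicy π := by
  classical
  have hX : X ∉ G.context := LDAG.notMem_context hPaPi hcontext
  have hfactor : ∀ c, FactorizesOutside (G.policyEdge X PaPi) G.context (M.kernelDo π)
      ((M.fixContext c).doPolicy π) := by
    intro c
    refine ((M.fixContext c).factorizesOutside_doPolicy π |>.mono
      (fun p w => Or.imp_left And.left) (Set.empty_subset _)).congr
      fun w hw => (M.domRestrict_ae_eq_doPolicy_fixContext c π hX).mono fun a ha => ?_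
    obtain rfl | hwX := eq_or_ne w X
    · rw [kernelDo_self_apply, kernelDo_self_apply]
    · rw [kernelDo_of_ne _ π hwX, kernelDo_of_ne _ π hwX, kernel_fixContext c hM hw ha]
  exact ((M.factorizesOutside_doPolicy π).mono le_rfl (Set.empty_subset _)).eq_bind
    (LDAG.policyEdge_wf hPaPi)
    (fun p w hpw hw => hpw.elim (fun h => hparents h hw) fun h => absurd hw (h.2 ▸ hX))
    (M.dependsOn_kernelDo π) (ν := fun c => (M.fixContext c).doPolicy π) .of_discrete hfactor
    (fun c => M.domRestrict_ae_eq_doPolicy_fixContext c π hX)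
    (M.agreesOn_doPolicy_law π hparents hX)

theorem obs_fixContext (hM : M.Compatible) (hparents : Ancestral G.edge G.context)
    (hO : G.context ⊆ O) (hc : M.law (G.context.domRestrict ⁻¹' {c}) ≠ 0) :
    (M.fixContext c).obs O = (M.obs O)[|Set.domRestrict₂ hO ⁻¹' {c}] := by
  have hcond : M.law[|G.context.domRestrict ⁻¹' {c}] = (M.fixContext c).law :=
    cond_preimage_singleton_of_eq_bind (Set.measurable_restrict _)
      (ν := fun c => (M.fixContext c).law) .of_discrete (law_eq_bind_fixContext hM hparents)
      M.domRestrict_ae_eq_law_fixContext hc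
  rw [obs, ← hcond]
  exact (cond_map (Set.measurable_restrict O)
    (Set.measurable_restrict₂ hO (measurableSet_singleton c))).symm

end SCM

section ContextPolicy

variable {C : Set V} [Finite C] [∀ w : C, Countable (D w)] [∀ w : C, DiscreteMeasurableSpace (D w)]

/-- The policy that chooses a policy by the values of the variables in `C` and follows it. -/
noncomputable def contextPolicy (hC : C ⊆ PaPi) (F : (∀ w : C, D w) → Policy D X PaPi) :
    Policy D X PaPi :=
  ⟨{ toFun := fun pa => (F (Set.domRestrict₂ hC pa)).1 pa
     measurable' := by
      have hF : Measurable fun q : (∀ w : PaPi, D w) × (∀ w : C, D w) => (F q.2).1 q.1 :=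
        measurable_from_prod_countable_left fun c => (F c).1.measurable
      exact hF.comp (measurable_id.prodMk (Set.measurable_restrict₂ hC)) },
    ⟨fun pa => (F (Set.domRestrict₂ hC pa)).2.isProbabilityMeasure pa⟩⟩

end ContextPolicy

variable [Fintype V] [∀ w, Nonempty (D w)] [∀ w : G.context, Countable (D w)]
  [∀ w : G.context, DiscreteMeasurableSpace (D w)]

theorem SCM.doPolicy_contextPolicy (M : SCM G) (c : ∀ w : G.context, D w)
    (hcontext : G.context ⊆ PaPi) (F : (∀ w : G.context, D w) → Policy D X PaPi) :
    (M.fixContext c).doPolicy (contextPolicy hcontext F) = (M.fixContext c).doPolicy (F c) := by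
  rw [doPolicy, doPolicy]
  congr 1
  funext e
  change ((F (G.context.domRestrict _)).1 _).map _ = _
  rw [domRestrict_sol_fixContext]

theorem imitable_of_forall_induced (hPaPi : Disjoint PaPi (G.De X)) (hO : G.context ⊆ O)
    (hcontext : G.context ⊆ PaPi) (hparents : Ancestral G.edge G.context)
    (h : ∀ c, Imitable (G.induced c) O X Y PaPi) : Imitable G O X Y PaPi := by
  choose Φ hΦ using h
  refine ⟨fun P => contextPolicy hcontext fun c => Φ c P[|Set.domRestrict₂ hO ⁻¹' {c}],
    fun M hM => ?_⟩
  have measurable_context {γ : Type _} [MeasurableSpace γ] (g : (∀ w : G.context, D w) → γ) :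
      Measurable fun a => g (G.context.domRestrict a) :=
    Measurable.of_discrete.comp (Set.measurable_restrict G.context)
  rw [SCM.doPolicy_eq_bind_fixContext _ hM hPaPi hcontext hparents,
    map_bind (measurable_context fun c => (M.fixContext c).doPolicy _) (measurable_pi_apply Y)]
  conv_rhs => rw [SCM.law_eq_bind_fixContext hM hparents,
    map_bind (measurable_context fun c => (M.fixContext c).law) (measurable_pi_apply Y)]
  refine Measure.bind_congr_right ?_
  filter_upwards [ae_measure_preimage_singleton_ne_zero (μ := M.law)
    (Set.measurable_restrict G.context)] with a ha
  rw [M.doPolicy_contextPolicy, ← SCM.obs_fixContext _ hM hparents hO ha]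
  exact hΦ _ _ (M.compatible_fixContext _)

end Context

section Lift

variable {V : Type v} {D : V → Type u} [∀ w, MeasurableSpace (D w)] {G : LDAG D}
  {c : ∀ w : G.context, D w} {i j w X Y : V} {O PaPi : Set V}

namespace LDAG

/-- In every model compatible with `G`, giving the context variables among the parents of `j` the
values that they have in `q` yields the same mechanism of `j` as giving them their values in the
context `c`. -/
def SameMechanism (G : LDAG D) (c : ∀ w : G.context, D w) (q : ∀ p : G.Pa j, D p) : Prop :=
  ∀ M : SCM G, M.Compatible → ∀ r r' : ∀ p : G.Pa j, D p,
    (∀ p : G.Pa j, (p : V) ∈ G.context → r p = q p) → Agree r' c →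
    (∀ p : G.Pa j, (p : V) ∉ G.context → r p = r' p) → M.mechanism j r = M.mechanism j r'

theorem sameMechanism_of_agree {q : ∀ p : G.Pa j, D p} (hq : Agree q c) :
    G.SameMechanism c q := by
  intro M _ r r' hr hr' hrr'
  refine congrArg _ (funext fun p => ?_)
  by_cases hp : (p : V) ∈ G.context
  · rw [hr p hp, hq p hp, hr' p hp]
  · exact hrr' p hp

theorem dependsOn_sameMechanism :
    DependsOn (G.SameMechanism c (j := j)) {p | (p : V) ∈ G.context} := by
  intro q q' hqq'
  refine propext (forall₄_congr fun M _ r r' => imp_congr_left ?_)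
  exact forall₂_congr fun p hp => by rw [hqq' p hp]

theorem measurableSet_sameMechanism [Finite V] [∀ w : G.context, Countable (D w)]
    [∀ w : G.context, DiscreteMeasurableSpace (D w)] :
    MeasurableSet {q : ∀ p : G.Pa j, D p | G.SameMechanism c q} := by
  let T : Set (G.Pa j) := {p | (p : V) ∈ G.context}
  have countable : ∀ p : T, Countable (D p.1) := fun p =>
    inferInstanceAs (Countable (D (⟨p.1, p.2⟩ : G.context)))
  have discrete : ∀ p : T, DiscreteMeasurableSpace (D p.1) := fun p =>
    inferInstanceAs (DiscreteMeasurableSpace (D (⟨p.1, p.2⟩ : G.context)))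
  obtain ⟨g, hg⟩ := dependsOn_iff_exists_comp.1 (G.dependsOn_sameMechanism (c := c) (j := j))
  have hgm : Measurable g := .of_discrete
  refine measurableSet_setOfPred.2 ?_
  rw [hg]
  exact hgm.comp (Set.measurable_restrict T)

variable {l : Realization D} {q q' : ∀ p : G.Pa j, D p}

theorem SameMechanism.of_label (hl : l ∈ G.label i j) (hq : Agree q l.val) (hq' : Agree q' l.val)
    (hqq' : ∀ p : G.Pa j, (p : V) ≠ i → q p = q' p) (hs : G.SameMechanism c q) :
    G.SameMechanism c q' := by
  intro M hM r r' hr hr' hrr'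
  let T : Set (G.Pa j) := {p | (p : V) ∈ G.context}
  let r₁ := overwrite T (T.domRestrict q) r
  have r₁_on : ∀ p ∈ T, r₁ p = q p := fun p hp => overwrite_of_mem _ _ hp
  have r₁_off : ∀ p ∉ T, r₁ p = r p := fun p hp => overwrite_of_notMem _ _ hp
  have r_eq_r₁ : M.mechanism j r = M.mechanism j r₁ := by
    refine hM i j l hl r r₁
      (fun p hp => (hr p (mem_context_of_label hl hp)).trans (hq' p hp))
      (fun p hp => (r₁_on p (mem_context_of_label hl hp)).trans (hq p hp)) fun p hp => ?_
    by_cases hpT : p ∈ T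
    · rw [hr p hpT, r₁_on p hpT, hqq' p hp]
    · rw [r₁_off p hpT]
  exact r_eq_r₁.trans (hs M hM r₁ r' r₁_on hr' fun p hp => (r₁_off p hp).trans (hrr' p hp))

theorem absent_of_label (hl : l ∈ G.label i j) (hi : i ∉ G.context) (hq : Agree q l.val)
    (hs : G.SameMechanism c q) :
    G.Absent c i j := by
  refine ⟨⟨G.context ∩ G.Pa j, fun w => c ⟨w, w.2.1⟩⟩,
    ⟨fun w hw => ⟨hw.2, fun hwi => hi (hwi ▸ hw.1)⟩, fun M hM r r' hr hr' hrr' => ?_⟩,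
    Set.inter_subset_left, fun _ => rfl⟩
  let T : Set (G.Pa j) := {p | (p : V) ∈ G.context}
  let move : (∀ p : G.Pa j, D p) → ∀ p : G.Pa j, D p := overwrite T (T.domRestrict q)
  have move_on : ∀ r, ∀ p ∈ T, move r p = q p := fun r p hp => overwrite_of_mem _ _ hp
  have move_off : ∀ r, ∀ p ∉ T, move r p = r p := fun r p hp => overwrite_of_notMem _ _ hp
  have mechanism_move : ∀ r, Agree r c → M.mechanism j (move r) = M.mechanism j r := fun r hr =>
    hs M hM _ r (move_on r) hr (move_off r)
  have move_agree : ∀ r, Agree (move r) l.val := fun r p hp =>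
    (move_on r p (mem_context_of_label hl hp)).trans (hq p hp)
  rw [← mechanism_move r fun p hp => hr p ⟨hp, p.2⟩,
    ← mechanism_move r' fun p hp => hr' p ⟨hp, p.2⟩]
  refine hM i j l hl _ _ (move_agree r) (move_agree r') fun p hp => ?_
  by_cases hpT : p ∈ T
  · rw [move_on r p hpT, move_on r' p hpT]
  · rw [move_off r p hpT, move_off r' p hpT, hrr' p hp]

end LDAG

namespace SCM

variable [Finite V] [∀ w, Nonempty (D w)] [∀ w : G.context, Countable (D w)]
  [∀ w : G.context, DiscreteMeasurableSpace (D w)] (M : SCM (G.induced c))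

open Classical in
/-- The model on the labeled DAG whose context variables have the constant value `c`, and whose
other variables follow `M` if the labels of `G` force them to behave as in the context `c`, and are
constant otherwise. -/
noncomputable def liftContext : SCM G where
  U := M.U
  mU := M.mU
  P := M.P
  prob := M.prob
  f w pa u := if h : w ∈ G.context then c ⟨w, h⟩ else
    if G.SameMechanism c pa then M.f w (fun p => pa ⟨p, p.2.1⟩) u else Classical.arbitrary _
  measurable_f w := by
    by_cases h : w ∈ G.context
    · simp only [h, dif_pos]
      exact measurable_const
    · simp only [h, dif_neg, not_false_iff]
      refine Measurable.ite (measurable_fst LDAG.measurableSet_sameMechanism) ?_ measurable_const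
      refine (M.measurable_f w).comp (Measurable.prodMk ?_ measurable_snd)
      exact measurable_pi_lambda _ fun p => (measurable_pi_apply _).comp measurable_fst

theorem liftContext_f_of_mem (hw : w ∈ G.context) (pa : ∀ p : G.Pa w, D p) (u : M.U w) :
    M.liftContext.f w pa u = c ⟨w, hw⟩ :=
  dif_pos hw

theorem liftContext_f_of_sameMechanism (hw : w ∉ G.context) {pa : ∀ p : G.Pa w, D p}
    (hs : G.SameMechanism c pa) (u : M.U w) :
    M.liftContext.f w pa u = M.f w (fun p => pa ⟨p, p.2.1⟩) u :=
  (dif_neg hw).trans (if_pos hs)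

theorem liftContext_f_of_not_sameMechanism (hw : w ∉ G.context) {pa : ∀ p : G.Pa w, D p}
    (hs : ¬ G.SameMechanism c pa) (u : M.U w) :
    M.liftContext.f w pa u = Classical.arbitrary _ :=
  (dif_neg hw).trans (if_neg hs)

theorem compatible_liftContext : M.liftContext.Compatible := by
  intro i j l hl q q' hq hq' hqq'
  refine congrArg ((M.P j).map) (funext fun u => ?_)
  by_cases hj : j ∈ G.context
  · exact (M.liftContext_f_of_mem hj q u).trans (M.liftContext_f_of_mem hj q' u).symm
  have hiff : G.SameMechanism c q ↔ G.SameMechanism c q' :=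
    ⟨.of_label hl hq hq' hqq', .of_label hl hq' hq fun p hp => (hqq' p hp).symm⟩
  by_cases hs : G.SameMechanism c q
  · have same_parents : (fun p : (G.induced c).Pa j => q ⟨p, p.2.1⟩) =
        fun p : (G.induced c).Pa j => q' ⟨p, p.2.1⟩ := by
      refine funext fun p => hqq' _ ?_
      rintro rfl
      exact p.2.2.2.2 (LDAG.absent_of_label hl p.2.2.1 hq hs)
    exact (M.liftContext_f_of_sameMechanism hj hs u).trans
      ((congrArg (M.f j · u) same_parents).trans
        (M.liftContext_f_of_sameMechanism hj (hiff.1 hs) u).symm)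
  · exact (M.liftContext_f_of_not_sameMechanism hj hs u).trans
      (M.liftContext_f_of_not_sameMechanism hj (mt hiff.2 hs) u).symm

theorem liftContext_f_overwrite (hw : w ∉ G.context) (a : ∀ v, D v) (u : M.U w) :
    M.liftContext.f w (fun p => overwrite G.context c a p) u = M.f w (fun p => a p) u := by
  rw [M.liftContext_f_of_sameMechanism hw
    (LDAG.sameMechanism_of_agree fun p hp => overwrite_of_mem _ _ hp)]
  exact congrArg (fun pa => M.f w pa u) (funext fun p => overwrite_of_notMem _ _ p.2.2.1)

theorem sol_liftContext (e : ∀ w, M.U w) :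
    M.liftContext.sol e = overwrite G.context c (M.sol e) := by
  funext w
  induction w using G.edge_wf.induction with
  | _ w ih =>
    refine (M.liftContext.sol_apply e w).trans ?_
    refine (congrArg (M.liftContext.f w · (e w)) (funext fun p : G.Pa w => ih p p.2)).trans ?_
    by_cases hw : w ∈ G.context
    · rw [overwrite_of_mem _ _ hw]
      exact M.liftContext_f_of_mem hw _ _
    · rw [overwrite_of_notMem _ _ hw, M.sol_apply]
      exact M.liftContext_f_overwrite hw _ _

theorem solDo_liftContext (hX : X ∉ G.context) (x : D X) (e : ∀ w, M.U w) :
    M.liftContext.solDo X x e = overwrite G.context c (M.solDo X x e) := by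
  funext w
  induction w using G.edge_wf.induction with
  | _ w ih =>
    obtain rfl | hwX := eq_or_ne w X
    · rw [overwrite_of_notMem _ _ hX, M.solDo_self]
      exact M.liftContext.solDo_self x e
    refine (M.liftContext.solDo_of_ne x e hwX).trans ?_
    refine (congrArg (M.liftContext.f w · (e w)) (funext fun p : G.Pa w => ih p p.2)).trans ?_
    by_cases hw : w ∈ G.context
    · rw [overwrite_of_mem _ _ hw]
      exact M.liftContext_f_of_mem hw _ _
    · rw [overwrite_of_notMem _ _ hw, M.solDo_of_ne _ _ hwX]
      exact M.liftContext_f_overwrite hw _ _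

end SCM

/-- The policy that follows `π` as if the variables in `C` had the values `c`. -/
noncomputable def pretendPolicy {C : Set V} (c : ∀ w : C, D w) (π : Policy D X PaPi) :
    Policy D X PaPi :=
  ⟨π.1.comap (overwriteOn PaPi c) (measurable_overwriteOn PaPi c),
    Kernel.IsMarkovKernel.comap _ _⟩

variable [Fintype V] [∀ w, Nonempty (D w)] [∀ w : G.context, Countable (D w)]
  [∀ w : G.context, DiscreteMeasurableSpace (D w)]

namespace SCM

variable (M : SCM (G.induced c))

theorem law_liftContext : M.liftContext.law = M.law.map (overwrite G.context c) := by
  rw [law, law, Measure.map_map (measurable_overwrite c) M.measurable_sol]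
  exact congrArg M.noise.map (funext M.sol_liftContext)

theorem obs_liftContext : M.liftContext.obs O = (M.obs O).map (overwriteOn O c) := by
  rw [obs, obs, law_liftContext]
  exact (Measure.map_map (Set.measurable_restrict O) (measurable_overwrite c)).trans
    (Measure.map_map (measurable_overwriteOn O c) (Set.measurable_restrict O)).symm

theorem doPolicy_liftContext (hX : X ∉ G.context) (π : Policy D X PaPi) :
    M.liftContext.doPolicy π = (M.doPolicy (pretendPolicy c π)).map (overwrite G.context c) := by
  rw [doPolicy, doPolicy, map_bind (M.measurable_map_solDo _) (measurable_overwrite c)]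
  refine congrArg M.noise.bind (funext fun e => ?_)
  refine (congrArg₂ (fun a s => (π.1 (PaPi.domRestrict a)).map s) (M.sol_liftContext e)
    (funext fun x => M.solDo_liftContext hX x e)).trans ?_
  exact (Measure.map_map (measurable_overwrite c) (M.measurable_solDo e)).symm

end SCM

theorem Imitable.induced (h : Imitable G O X Y PaPi) (hX : X ∉ G.context)
    (c : ∀ w : G.context, D w) : Imitable (G.induced c) O X Y PaPi := by
  obtain ⟨Φ, hΦ⟩ := h
  refine ⟨fun P => pretendPolicy c (Φ (P.map (overwriteOn O c))), fun M _ => ?_⟩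
  by_cases hY : Y ∈ G.context
  · exact (M.agreesOn_doPolicy_law _ LDAG.ancestral_context_induced hX).map_eq
      (measurable_pi_apply Y) fun a b hab => hab Y hY
  have eval_overwrite : (fun a => a Y) ∘ overwrite G.context c = fun a => a Y :=
    funext fun a => overwrite_of_notMem c a hY
  have imitates := hΦ M.liftContext M.compatible_liftContext
  rwa [M.obs_liftContext, M.doPolicy_liftContext hX, M.law_liftContext,
    Measure.map_map (measurable_pi_apply Y) (measurable_overwrite c),
    Measure.map_map (measurable_pi_apply Y) (measurable_overwrite c), eval_overwrite] at imitates

end Lift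

theorem mainTheorem2_general {V : Type v} [Fintype V] {D : V → Type u}
    [∀ w, MeasurableSpace (D w)] [∀ w, Nonempty (D w)]
    (G : LDAG D) (O : Set V) (X Y : V) (PaPi : Set V)
    (hPaPi : Disjoint PaPi (G.De X))
    (hdiscrete : ∀ w ∈ G.context, Countable (D w) ∧ DiscreteMeasurableSpace (D w))
    (hO : G.context ⊆ O)
    (hcontext : G.context ⊆ PaPi)
    (hparents : ∀ w ∈ G.context, G.Pa w ⊆ G.context) :
    Imitable G O X Y PaPi ↔
      ∀ c : (∀ w : G.context, D w), Imitable (G.induced c) O X Y PaPi := by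
  have countable (w : G.context) : Countable (D w) := (hdiscrete w w.2).1
  have discrete (w : G.context) : DiscreteMeasurableSpace (D w) := (hdiscrete w w.2).2
  exact ⟨fun h => h.induced (LDAG.notMem_context hPaPi hcontext),
    imitable_of_forall_induced hPaPi hO hcontext fun _ w hp hw => hparents w hw hp⟩

end CSIImitation

open CSIImitation in
theorem mainTheorem2 {V : Type v} [Fintype V] {D : V → Type u}
    [∀ w, MeasurableSpace (D w)] [∀ w, Nonempty (D w)]
    (G : LDAG D) (O : Set V) (X Y : V) (PaPi : Set V)
    (hX : X ∈ O)
    (hPaPi : PaPi ⊆ O \ G.De X)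
    (hdiscrete : ∀ w ∈ G.context, Countable (D w) ∧ DiscreteMeasurableSpace (D w))
    (hcontext : G.context ⊆ PaPi)
    (hparents : ∀ w ∈ G.context, G.Pa w ⊆ G.context) :
    Imitable G O X Y PaPi ↔
      ∀ c : (∀ w : G.context, D w), Imitable (G.induced c) O X Y PaPi :=
  mainTheorem2_general G O X Y PaPi (Set.disjoint_left.2 fun _ h => (hPaPi h).2) hdiscrete
    (fun _ hw => (hPaPi (hcontext hw)).1) hcontext hparents
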